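/- For integers $k_1,\dots,k_d\ge 1$ with $k_1\ge 2$, let $$\zeta(k_1,\dots,k_d)=\sum_{m_1>m_2>\cdots>m_d>0}\frac{1}{m_1^{k_1}m_2^{k_2}\cdots m_d^{k_d}}$$ be the multiple zeta value, where the sum runs over all tuples of integers $m_1>\cdots>m_d>0$. Write $\{a_1,\dots,a_r\}_p$ for the sequence $a_1,\dots,a_r$ repeated $p$ times (the empty sequence if $p=0$), and let the Bernoulli numbers $B_k$ be defined by $\sum_{k\ge 0}B_k\frac{t^k}{k!}=\frac{te^t}{e^t-1}$. Then for every integer $n\ge 0$ (empty sums being $0$) the following two identities hold. (i) (weight $4n+2$) $$\begin{aligned}\pi^{4n+2}\sum_{p=0}^{n-1}(-1)^{p+1}\frac{4^{2n-p+1}B_{4n-4p+2}}{(4p+2)!\,(4n-4p+2)!} ={}&-2\sum_{p=0}^{n-1}(-4)^p\,\zeta(\{3,1\}_p,3,3,\{2\}_{2(n-p-1)})\\ &-3\sum_{p=0}^{n-1}(-4)^p\,\zeta(\{3,1\}_p,4,\{2\}_{2(n-p)-1})\\ &+2(-4)^n\sum_{p=0}^{n-1}\zeta(\{3,1\}_p,5,1,\{3,1\}_{n-p-1}).\end{aligned}$$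 (ii) (weight $4n+4$) $$\begin{aligned}\frac{(-1)^n\,2\cdot 4^{n+1}(n+1)\,\pi^{4n+4}}{(4n+6)!} ={}&2\sum_{p=0}^{n-1}(-4)^p\,\zeta(\{3,1\}_p,3,3,\{2\}_{2(n-p)-1}) +3\sum_{p=0}^{n}(-4)^p\,\zeta(\{3,1\}_p,4,\{2\}_{2(n-p)})\\ &-2(-4)^n\sum_{p=0}^{n-1}\zeta(\{3,1\}_p,3,4,1,\{3,1\}_{n-p-1}) -2(-4)^n\sum_{p=0}^{n}\zeta(\{3,1\}_p,4,\{3,1\}_{n-p}).\end{aligned}$$ -/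

import Mathlib

/-- The index set of the series defining `ζ(k₁, …, k_d)`: all tuples of integers
`m₁ > m₂ > ⋯ > m_d > 0`. For `d = 0` it consists of the empty tuple alone. -/
abbrev MZVIndex (d : ℕ) : Type :=
  {m : Fin d → ℕ // StrictAnti m ∧ ∀ i, 0 < m i}

/-- The general term `1 / (m₁ ^ k₁ ⋯ m_d ^ k_d)`. -/
noncomputable def mzvTerm (k : List ℕ) (m : MZVIndex k.length) : ℝ :=
  1 / ∏ i : Fin k.length, (m.1 i : ℝ) ^ k.get i

/-- The multiple zeta value
`ζ(k₁, …, k_d) = ∑_{m₁ > ⋯ > m_d > 0} 1 / (m₁ ^ k₁ ⋯ m_d ^ k_d)`,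
meaningful when all `kᵢ ≥ 1` and `k₁ ≥ 2`: see `summable_mzvTerm`. -/
noncomputable def multiZeta (k : List ℕ) : ℝ :=
  ∑' m : MZVIndex k.length, mzvTerm k m

/-- The list `w` repeated `p` times: `{w}_p`. -/
def repeatList (w : List ℕ) (p : ℕ) : List ℕ :=
  (List.replicate p w).flatten

/-- A product of summable nonnegative functions of independent variables is summable. -/
theorem summable_pi_prod (g : ℕ → ℝ) (h0 : ∀ n, 0 ≤ g n) (hg : Summable g) (d : ℕ) :
    Summable fun m : Fin d → ℕ => ∏ i, g (m i) := by
  induction d with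
  | zero => exact Summable.of_finite
  | succ d ih =>
    rw [← (Fin.consEquiv fun _ : Fin (d + 1) => ℕ).summable_iff]
    refine (hg.mul_of_nonneg ih h0 fun m => Finset.prod_nonneg fun i _ => h0 _).congr ?_
    rintro ⟨a, m⟩
    simp [Fin.consEquiv, Fin.prod_univ_succ]

/-- The defining series of a multiple zeta value converges when all `kᵢ ≥ 1` and `k₁ ≥ 2`. -/
theorem summable_mzvTerm (a : ℕ) (l : List ℕ) (ha : 2 ≤ a) (hl : ∀ b ∈ l, 1 ≤ b) :
    Summable (mzvTerm (a :: l)) := by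
  set d : ℕ := (a :: l).length with hd
  have hdpos : 0 < d := by simp [hd]
  have hd0 : (0 : ℝ) < d := by exact_mod_cast hdpos
  have hs : Summable fun n : ℕ => 1 / (n : ℝ) ^ (1 + 1 / (d : ℝ)) :=
    Real.summable_one_div_nat_rpow.2 (by have := one_div_pos.2 hd0; linarith)
  have hp := summable_pi_prod _ (fun n => by positivity) hs d
  have hq := hp.comp_injective (Subtype.val_injective :
    Function.Injective (fun m : MZVIndex d => m.1))
  refine Summable.of_nonneg_of_le (fun m => ?_) (fun m => ?_) hq
  · unfold mzvTerm; positivity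
  obtain ⟨m, hm, hm0⟩ := m
  have hm1 : ∀ i, (1 : ℝ) ≤ m i := fun i => by exact_mod_cast hm0 i
  have hpos : ∀ i, (0 : ℝ) < m i := fun i => lt_of_lt_of_le one_pos (hm1 i)
  simp only [mzvTerm, Function.comp, Finset.prod_div_distrib, Finset.prod_const_one]
  refine one_div_le_one_div_of_le
    (Finset.prod_pos fun i _ => Real.rpow_pos_of_pos (hpos i) _) ?_
  have h1 : ∏ i, (m i : ℝ) ^ (1 + 1 / (d : ℝ)) =
      (∏ i, (m i : ℝ)) * ∏ i, (m i : ℝ) ^ (1 / (d : ℝ)) := by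
    rw [← Finset.prod_mul_distrib]
    exact Finset.prod_congr rfl fun i _ => by rw [Real.rpow_add (hpos i), Real.rpow_one]
  let z : Fin d := ⟨0, hdpos⟩
  have h2 : ∏ i, (m i : ℝ) ^ (1 / (d : ℝ)) ≤ m z := by
    calc ∏ i, (m i : ℝ) ^ (1 / (d : ℝ)) ≤ ∏ _i : Fin d, (m z : ℝ) ^ (1 / (d : ℝ)) := by
          refine Finset.prod_le_prod (fun i _ => by positivity) fun i _ => ?_
          refine Real.rpow_le_rpow (hpos i).le ?_ (by positivity)
          exact_mod_cast hm.antitone (Fin.mk_le_of_le_val (Nat.zero_le _) : z ≤ i)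
      _ = m z := by
          rw [Finset.prod_const, Finset.card_univ, Fintype.card_fin, one_div,
            Real.rpow_inv_natCast_pow (hpos z).le hdpos.ne']
  rw [h1]
  refine (mul_le_mul_of_nonneg_left h2 (Finset.prod_nonneg fun i _ => (hpos i).le)).trans ?_
  have hz : (m z : ℝ) = ∏ i : Fin d, if i = z then (m i : ℝ) else 1 := by
    simp
  rw [hz, ← Finset.prod_mul_distrib]
  refine Finset.prod_le_prod (fun i _ => ?_) fun i _ => ?_
  · split_ifs <;> nlinarith [hpos i]
  · split_ifs with h
    · subst h
      calc (m z : ℝ) * m z = (m z : ℝ) ^ 2 := by ring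
        _ ≤ _ := pow_le_pow_right₀ (hm1 z) ha
    · rw [mul_one]
      have hne : i.1 ≠ 0 := fun h' => h (Fin.ext h')
      have hk : 1 ≤ (a :: l).get i := by
        obtain ⟨j, hj⟩ := Nat.exists_eq_succ_of_ne_zero hne
        refine le_trans ?_ (le_refl _)
        rw [List.get_eq_getElem]
        simp only [hj, Nat.succ_eq_add_one, List.getElem_cons_succ]
        exact hl _ (List.getElem_mem _)
      exact le_self_pow₀ (hm1 i) (by omega)

/-!
The proof reads multiple zeta values as values at `t = 1` of multiple polylogarithms, which are
handled as formal power series in `t`. Write `x` and `y` for integration against `dt/t` and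
`dt/(1-t)`, so that the polylogarithm of `(k₁, …, k_d)` is the word `x^{k₁-1} y ⋯ x^{k_d-1} y`, and
put
`F = ∑ (-z)ⁱ (xy)ⁱ`, `G = ∑ zⁱ (xy)ⁱ`, `N = ∑_{a ≥ 0, b ≥ 1} z^{a+b} (xy)ᵃ xx (xy)ᵇ`.

Differentiating products with `θ = t d/dt` shows `F G = 1 - 4 z² xxyy (F G)`, so that
`F G = ∑ (-4 z²)ⁿ (xxyy)ⁿ` (`IsShufflePair.mul_eq`). In the same way the product `F N` satisfies
`F N = -4 z² xxyy (F N) + (inhomogeneous terms)`, where the inhomogeneous terms are short words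
applied to `F` and to `F G` (`IsShufflePair.mul_insertion_eq`). Solving this recursion for the
coefficients of `z`, the right-hand side of the weight `4n+2` identity is the coefficient of
`z^{2n}` in `F N`, and that of the weight `4n+4` identity is the coefficient of `z^{2n+1}`
(`coeff_even_altTwos_mul_insertFour`, `coeff_odd_altTwos_mul_insertFour`).

At `t = 1` the series `F` becomes `∏ (1 - z/m²)`, and `N` becomes
`∏ (1 + z/m²) * ∑_m (z/m⁴) / (1 + z/m²)`, because a sum over all insertions of a `4` into `{2}_k`
is symmetric in the summation indices. Hence the value of `F N` is
`z ∏ (1 - z²/m⁴) ∑_k (-1)ᵏ ζ(2k+4) zᵏ` (`evalNegHom_twosValue_mul_insertFourValue`). Its even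
coefficients involve `ζ(4q+2)`, that is, Bernoulli numbers; its odd coefficients collapse by
Newton's identities. The coefficients of `∏ (1 - z²/m⁴)` follow from those of
`∏ (1 + z/m²)`, which Euler's product for the sine provides (`multiZeta_repeatList_two`).
-/

open PowerSeries Filter Topology
open scoped PowerSeries.WithPiTopology

/-! ### Polylogarithms as formal power series -/

/-- The multiple polylogarithm of the index list `k`, as a formal power series in `t`:
`∑_{m₁ > ⋯ > m_d > 0} t ^ m₁ / (m₁ ^ k₁ ⋯ m_d ^ k_d)`, with the value `1` at the empty list. The
constant coefficient `1` of the empty list plays the role of an innermost index `m = 0`. -/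
noncomputable def polylogSeries : List ℕ → ℝ⟦X⟧
  | [] => 1
  | k :: l => PowerSeries.mk fun n =>
      (∑ j ∈ Finset.range n, coeff j (polylogSeries l)) / (n : ℝ) ^ k

/-- The Euler operator `θ = t d/dt`. -/
noncomputable def eulerOp : ℝ⟦X⟧ →ₗ[ℝ] ℝ⟦X⟧ where
  toFun f := PowerSeries.mk fun n => n * coeff n f
  map_add' f g := by ext n; simp [mul_add]
  map_smul' c f := by ext n; simp; ring

/-- Integration against `dt/t`, written `x` below. It is a right inverse of `θ` on series without
constant term; the constant term of the argument is discarded, as `c / 0 = 0`. -/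
noncomputable def intX : ℝ⟦X⟧ →ₗ[ℝ] ℝ⟦X⟧ where
  toFun f := PowerSeries.mk fun n => coeff n f / n
  map_add' f g := by ext n; simp [add_div]
  map_smul' c f := by ext n; simp [mul_div_assoc]

/-- Integration against `dt/(1-t)`, written `y` below: it satisfies `θ (y f) = t/(1-t) * f`. -/
noncomputable def intY : ℝ⟦X⟧ →ₗ[ℝ] ℝ⟦X⟧ where
  toFun f := PowerSeries.mk fun n => (∑ j ∈ Finset.range n, coeff j f) / n
  map_add' f g := by ext n; simp [add_div, Finset.sum_add_distrib]
  map_smul' c f := by ext n; simp [mul_div_assoc, ← Finset.mul_sum]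

/-- The series of `t/(1-t)`. -/
noncomputable def geomTail : ℝ⟦X⟧ := PowerSeries.mk fun n => if n = 0 then 0 else 1

theorem coeff_eulerOp (n : ℕ) (f : ℝ⟦X⟧) : coeff n (eulerOp f) = n * coeff n f := by
  simp [eulerOp]

theorem coeff_intX (n : ℕ) (f : ℝ⟦X⟧) : coeff n (intX f) = coeff n f / n := by
  simp [intX]

theorem coeff_intY (n : ℕ) (f : ℝ⟦X⟧) :
    coeff n (intY f) = (∑ j ∈ Finset.range n, coeff j f) / n := by
  simp [intY]

theorem eulerOp_mul (f g : ℝ⟦X⟧) : eulerOp (f * g) = eulerOp f * g + f * eulerOp g := by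
  ext n
  simp only [coeff_eulerOp, map_add, coeff_mul, Finset.mul_sum, ← Finset.sum_add_distrib]
  refine Finset.sum_congr rfl fun p hp => ?_
  rw [← Finset.HasAntidiagonal.mem_antidiagonal.1 hp]
  push_cast
  ring

theorem intX_eulerOp {f : ℝ⟦X⟧} (hf : coeff 0 f = 0) : intX (eulerOp f) = f := by
  ext n
  rw [coeff_intX, coeff_eulerOp]
  rcases Nat.eq_zero_or_pos n with rfl | hn
  · simp [hf]
  · field_simp

theorem eulerOp_intX {f : ℝ⟦X⟧} (hf : coeff 0 f = 0) : eulerOp (intX f) = f := by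
  ext n
  rw [coeff_eulerOp, coeff_intX]
  rcases Nat.eq_zero_or_pos n with rfl | hn
  · simp [hf]
  · field_simp

theorem intX_geomTail_mul (f : ℝ⟦X⟧) : intX (geomTail * f) = intY f := by
  ext n
  rw [coeff_intX, coeff_intY, mul_comm, coeff_mul,
    Finset.Nat.sum_antidiagonal_eq_sum_range_succ_mk, Finset.sum_range_succ]
  congr 1
  simp only [geomTail, coeff_mk, Nat.sub_self, if_true, mul_zero, add_zero]
  refine Finset.sum_congr rfl fun j hj => ?_
  rw [if_neg (Nat.sub_ne_zero_of_lt (Finset.mem_range.1 hj)), mul_one]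

theorem coeff_zero_intX (f : ℝ⟦X⟧) : coeff 0 (intX f) = 0 := by rw [coeff_intX]; simp

theorem coeff_zero_intY (f : ℝ⟦X⟧) : coeff 0 (intY f) = 0 := by rw [coeff_intY]; simp

theorem eulerOp_intY (f : ℝ⟦X⟧) : eulerOp (intY f) = geomTail * f := by
  rw [← intX_geomTail_mul, eulerOp_intX]
  simp [coeff_mul, geomTail]

theorem intX_one : intX 1 = 0 := by
  ext n
  rw [coeff_intX, coeff_one]
  rcases Nat.eq_zero_or_pos n with rfl | hn
  · simp
  · simp [hn.ne']

theorem coeff_polylogSeries_cons (k : ℕ) (l : List ℕ) (n : ℕ) :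
    coeff n (polylogSeries (k :: l)) =
      (∑ j ∈ Finset.range n, coeff j (polylogSeries l)) / (n : ℝ) ^ k := by
  simp [polylogSeries]

theorem coeff_zero_polylogSeries_cons (k : ℕ) (l : List ℕ) :
    coeff 0 (polylogSeries (k :: l)) = 0 := by
  simp [coeff_polylogSeries_cons]

theorem intX_polylogSeries (k : ℕ) (l : List ℕ) :
    intX (polylogSeries (k :: l)) = polylogSeries ((k + 1) :: l) := by
  ext n
  rw [coeff_intX, coeff_polylogSeries_cons, coeff_polylogSeries_cons, pow_succ, div_div]

theorem intY_polylogSeries (l : List ℕ) : intY (polylogSeries l) = polylogSeries (1 :: l) := by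
  ext n
  rw [coeff_intY, coeff_polylogSeries_cons, pow_one]

/-! ### Generating series with polylogarithm coefficients -/

/-- The extension of a linear operator on series in `t` to generating series in a second variable
`z` (the outer variable) with coefficients in the series in `t`. -/
noncomputable def coeffwise (L : ℝ⟦X⟧ →ₗ[ℝ] ℝ⟦X⟧) : ℝ⟦X⟧⟦X⟧ →ₗ[ℝ] ℝ⟦X⟧⟦X⟧ where
  toFun f := PowerSeries.mk fun i => L (coeff i f)
  map_add' f g := by ext1 i; simp
  map_smul' c f := by ext1 i; simp

theorem coeff_coeffwise (L : ℝ⟦X⟧ →ₗ[ℝ] ℝ⟦X⟧) (i : ℕ) (f : ℝ⟦X⟧⟦X⟧) :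
    coeff i (coeffwise L f) = L (coeff i f) := by
  simp [coeffwise]

theorem coeffwise_X_mul (L : ℝ⟦X⟧ →ₗ[ℝ] ℝ⟦X⟧) (f : ℝ⟦X⟧⟦X⟧) :
    coeffwise L (X * f) = X * coeffwise L f := by
  ext1 i
  cases i <;> simp [coeff_coeffwise, coeff_succ_X_mul, coeff_zero_X_mul]

theorem coeffwise_eulerOp_mul (f g : ℝ⟦X⟧⟦X⟧) :
    coeffwise eulerOp (f * g) = coeffwise eulerOp f * g + f * coeffwise eulerOp g := by
  ext1 i
  simp only [coeff_coeffwise, coeff_mul, map_add, map_sum, eulerOp_mul, Finset.sum_add_distrib]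

/-- All coefficients of the generating series vanish at `t = 0`. -/
def VanishesAtZero (f : ℝ⟦X⟧⟦X⟧) : Prop := ∀ i, coeff 0 (coeff i f) = 0

theorem VanishesAtZero.add {f g : ℝ⟦X⟧⟦X⟧} (hf : VanishesAtZero f) (hg : VanishesAtZero g) :
    VanishesAtZero (f + g) := fun i => by rw [map_add, map_add, hf i, hg i, add_zero]

theorem VanishesAtZero.sub {f g : ℝ⟦X⟧⟦X⟧} (hf : VanishesAtZero f) (hg : VanishesAtZero g) :
    VanishesAtZero (f - g) := fun i => by rw [map_sub, map_sub, hf i, hg i, sub_zero]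

theorem VanishesAtZero.mul_left {f : ℝ⟦X⟧⟦X⟧} (hf : VanishesAtZero f) (g : ℝ⟦X⟧⟦X⟧) :
    VanishesAtZero (g * f) := fun i => by
  rw [coeff_mul, map_sum]
  refine Finset.sum_eq_zero fun p _ => ?_
  have := hf p.2
  rw [coeff_zero_eq_constantCoeff_apply] at this ⊢
  rw [map_mul, this, mul_zero]

theorem VanishesAtZero.mul_right {f : ℝ⟦X⟧⟦X⟧} (hf : VanishesAtZero f) (g : ℝ⟦X⟧⟦X⟧) :
    VanishesAtZero (f * g) := mul_comm g f ▸ hf.mul_left g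

theorem vanishesAtZero_intX (f : ℝ⟦X⟧⟦X⟧) : VanishesAtZero (coeffwise intX f) := fun i => by
  rw [coeff_coeffwise, coeff_zero_intX]

theorem vanishesAtZero_intY (f : ℝ⟦X⟧⟦X⟧) : VanishesAtZero (coeffwise intY f) := fun i => by
  rw [coeff_coeffwise, coeff_zero_intY]

theorem VanishesAtZero.intX_eulerOp {f : ℝ⟦X⟧⟦X⟧} (hf : VanishesAtZero f) :
    coeffwise intX (coeffwise eulerOp f) = f := by
  ext1 i
  rw [coeff_coeffwise, coeff_coeffwise, _root_.intX_eulerOp (hf i)]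

theorem VanishesAtZero.eulerOp_intX {f : ℝ⟦X⟧⟦X⟧} (hf : VanishesAtZero f) :
    coeffwise eulerOp (coeffwise intX f) = f := by
  ext1 i
  rw [coeff_coeffwise, coeff_coeffwise, _root_.eulerOp_intX (hf i)]

theorem coeffwise_eulerOp_intY (f : ℝ⟦X⟧⟦X⟧) :
    coeffwise eulerOp (coeffwise intY f) = C geomTail * f := by
  ext1 i
  rw [coeff_coeffwise, coeff_coeffwise, eulerOp_intY, coeff_C_mul]

theorem coeffwise_intX_geomTail_mul (f : ℝ⟦X⟧⟦X⟧) :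
    coeffwise intX (C geomTail * f) = coeffwise intY f := by
  ext1 i
  rw [coeff_coeffwise, coeff_coeffwise, coeff_C_mul, intX_geomTail_mul]

theorem coeffwise_intX_one : coeffwise intX 1 = 0 := by
  ext1 i
  rw [coeff_coeffwise, coeff_one]
  split_ifs <;> simp [intX_one]

theorem coeffwise_eulerOp_one : coeffwise eulerOp 1 = 0 := by
  ext i n
  rw [coeff_coeffwise, coeff_one]
  split_ifs
  · rw [coeff_eulerOp, coeff_one]; split_ifs with h <;> simp [h]
  · simp

/-- A series without constant term is recovered from its image under `θ`, written in terms of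
`dt/t` and `dt/(1-t)`. -/
theorem VanishesAtZero.eq_of_eulerOp {f g h : ℝ⟦X⟧⟦X⟧} (hf : VanishesAtZero f)
    (e : coeffwise eulerOp f = g + C geomTail * h) :
    f = coeffwise intX g + coeffwise intY h := by
  rw [← hf.intX_eulerOp, e, map_add, coeffwise_intX_geomTail_mul]

/-! ### Shuffle products of generating series -/

theorem coeffwise_two_mul (L : ℝ⟦X⟧ →ₗ[ℝ] ℝ⟦X⟧) (f : ℝ⟦X⟧⟦X⟧) :
    coeffwise L (2 * f) = 2 * coeffwise L f := by
  rw [two_mul, two_mul, map_add]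

/-- `F = ∑ (-z)ⁱ (xy)ⁱ` and `G = ∑ zⁱ (xy)ⁱ`, together with `F' = θ F` and `G' = θ G`, characterised
by their integral equations. Thus `F` and `G` solve the same hypergeometric equation with
opposite signs of `z`. -/
structure IsShufflePair (F F' G G' : ℝ⟦X⟧⟦X⟧) : Prop where
  left : F = 1 + coeffwise intX F'
  left_deriv : F' = -(X * coeffwise intY F)
  right : G = 1 + coeffwise intX G'
  right_deriv : G' = X * coeffwise intY G

namespace IsShufflePair

variable {F F' G G' : ℝ⟦X⟧⟦X⟧}

theorem vanish_left (h : IsShufflePair F F' G G') : VanishesAtZero F' := by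
  rw [h.left_deriv]
  intro i
  rw [map_neg, map_neg, (vanishesAtZero_intY F).mul_left X i, neg_zero]

theorem vanish_right (h : IsShufflePair F F' G G') : VanishesAtZero G' :=
  h.right_deriv ▸ (vanishesAtZero_intY G).mul_left X

theorem vanish_left_sub (h : IsShufflePair F F' G G') : VanishesAtZero (F - 1) := by
  rw [h.left, add_sub_cancel_left]; exact vanishesAtZero_intX _

theorem vanish_right_sub (h : IsShufflePair F F' G G') : VanishesAtZero (G - 1) := by
  rw [h.right, add_sub_cancel_left]; exact vanishesAtZero_intX _

theorem eulerOp_left (h : IsShufflePair F F' G G') : coeffwise eulerOp F = F' := by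
  conv_lhs => rw [h.left]
  rw [map_add, coeffwise_eulerOp_one, zero_add, h.vanish_left.eulerOp_intX]

theorem eulerOp_right (h : IsShufflePair F F' G G') : coeffwise eulerOp G = G' := by
  conv_lhs => rw [h.right]
  rw [map_add, coeffwise_eulerOp_one, zero_add, h.vanish_right.eulerOp_intX]

theorem eulerOp_left_deriv (h : IsShufflePair F F' G G') :
    coeffwise eulerOp F' = -(X * (C geomTail * F)) := by
  conv_lhs => rw [h.left_deriv]
  rw [map_neg, coeffwise_X_mul, coeffwise_eulerOp_intY]

theorem eulerOp_right_deriv (h : IsShufflePair F F' G G') :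
    coeffwise eulerOp G' = X * (C geomTail * G) := by
  conv_lhs => rw [h.right_deriv]
  rw [coeffwise_X_mul, coeffwise_eulerOp_intY]

theorem intX_sum (h : IsShufflePair F F' G G') :
    coeffwise intX (F' * G + F * G') = F * G - 1 := by
  have hv : VanishesAtZero (F * G - 1) := by
    have : F * G - 1 = (F - 1) * G + (G - 1) := by ring
    rw [this]
    exact (h.vanish_left_sub.mul_right G).add h.vanish_right_sub
  rw [← hv.intX_eulerOp, map_sub, coeffwise_eulerOp_mul, coeffwise_eulerOp_one, sub_zero,
    h.eulerOp_left, h.eulerOp_right]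

theorem sum_eq (h : IsShufflePair F F' G G') :
    F' * G + F * G' = 2 * coeffwise intX (F' * G') := by
  have hv : VanishesAtZero (F' * G + F * G') :=
    (h.vanish_left.mul_right G).add (h.vanish_right.mul_left F)
  rw [← coeffwise_two_mul, ← hv.intX_eulerOp, map_add, coeffwise_eulerOp_mul,
    coeffwise_eulerOp_mul, h.eulerOp_left, h.eulerOp_right, h.eulerOp_left_deriv,
    h.eulerOp_right_deriv]
  congr 1
  ring

theorem mul_deriv_eq (h : IsShufflePair F F' G G') :
    F' * G' = X * coeffwise intY (F' * G - F * G') := by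
  rw [← coeffwise_X_mul, ← (h.vanish_left.mul_right G').intX_eulerOp, coeffwise_eulerOp_mul,
    h.eulerOp_left_deriv, h.eulerOp_right_deriv, ← coeffwise_intX_geomTail_mul]
  congr 1
  ring

theorem diff_eq (h : IsShufflePair F F' G G') :
    F' * G - F * G' = -(2 * (X * coeffwise intY (F * G))) := by
  have hv : VanishesAtZero (F' * G - F * G') :=
    (h.vanish_left.mul_right G).sub (h.vanish_right.mul_left F)
  rw [← coeffwise_X_mul, ← coeffwise_two_mul, ← map_neg, ← hv.intX_eulerOp, map_sub,
    coeffwise_eulerOp_mul,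
    coeffwise_eulerOp_mul, h.eulerOp_left, h.eulerOp_right, h.eulerOp_left_deriv,
    h.eulerOp_right_deriv, ← coeffwise_intX_geomTail_mul]
  congr 1
  ring

/-- The alternating shuffle product of the words `(xy)ⁱ` consists of the words `(xxyy)ⁿ`:
`F G → F'G + FG' → F'G' → F'G - FG' → F G` is a closed cycle under `θ`, since the remaining terms
cancel between the two signs of `z`. -/
theorem mul_eq (h : IsShufflePair F F' G G') :
    F * G = 1 - 4 * (X ^ 2 * coeffwise intX (coeffwise intX
      (coeffwise intY (coeffwise intY (F * G))))) := by
  have e := h.intX_sum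
  rw [h.sum_eq, h.mul_deriv_eq, h.diff_eq] at e
  simp only [map_neg, coeffwise_two_mul, coeffwise_X_mul] at e
  linear_combination -e

theorem intX_left_deriv_mul (h : IsShufflePair F F' G G') :
    2 * coeffwise intX (F' * G - F') =
      F * G - 1 - 2 * (X * coeffwise intX (coeffwise intY (F * G))) - 2 * (F - 1) := by
  have e1 := h.intX_sum
  have e2 : coeffwise intX (F' * G - F * G') =
      -(2 * (X * coeffwise intX (coeffwise intY (F * G)))) := by
    rw [h.diff_eq, map_neg, coeffwise_two_mul, coeffwise_X_mul]
  have e3 := h.left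
  rw [map_add] at e1
  rw [map_sub] at e2 ⊢
  linear_combination e1 + e2 + 2 * e3

/-- Let `N` be the generating series of the words `(xy)ᵃ xx (xy)ᵇ` with `b ≥ 1`. The cycle behind
`mul_eq`, run for `F N`, closes up to inhomogeneous terms, all of which are iterated integrals of
`F G` and of `F`. -/
theorem mul_insertion_eq (h : IsShufflePair F F' G G') {N N' : ℝ⟦X⟧⟦X⟧}
    (hN : N = coeffwise intX N')
    (hN' : N' = X * coeffwise intY N + coeffwise intX (G - 1)) :
    F * N =
      -(4 * (X ^ 2 * coeffwise intX (coeffwise intX (coeffwise intY (coeffwise intY (F * N)))))) +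
      2 * coeffwise intX (coeffwise intX (F * G - 1)) -
      3 * coeffwise intX (coeffwise intX (F - 1)) -
      2 * (X * coeffwise intX (coeffwise intX (coeffwise intY (coeffwise intX (F * G - 1))))) +
      2 * (X * coeffwise intX (coeffwise intX (coeffwise intY (coeffwise intX (F - 1))))) -
      2 * (X * coeffwise intX (coeffwise intX (coeffwise intX (coeffwise intY (F * G))))) := by
  have vN : VanishesAtZero N := hN ▸ vanishesAtZero_intX _
  have vN' : VanishesAtZero N' := by
    rw [hN']
    exact ((vanishesAtZero_intY N).mul_left X).add (vanishesAtZero_intX _)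
  have dN : coeffwise eulerOp N = N' := by rw [hN, vN'.eulerOp_intX]
  have dN' : coeffwise eulerOp N' = X * (C geomTail * N) + (G - 1) := by
    conv_lhs => rw [hN']
    rw [map_add, coeffwise_X_mul, coeffwise_eulerOp_intY, h.vanish_right_sub.eulerOp_intX]
  -- One application of `θ` per step: `F N → F'N + FN' → F'N' → F'N - FN' → F N`.
  have e1 : F * N = coeffwise intX (F' * N + F * N') := by
    rw [← (vN.mul_left F).intX_eulerOp, coeffwise_eulerOp_mul, h.eulerOp_left, dN]
  have e2 : F' * N + F * N' = coeffwise intX (2 * (F' * N') + ((F * G - 1) - (F - 1))) := by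
    have hv := (vN.mul_left F').add (vN'.mul_left F)
    rw [← hv.intX_eulerOp, map_add, coeffwise_eulerOp_mul, coeffwise_eulerOp_mul,
      h.eulerOp_left, h.eulerOp_left_deriv, dN, dN']
    congr 1
    ring
  have e3 : F' * N - F * N' =
      coeffwise intX (-((F * G - 1) - (F - 1))) + coeffwise intY (-(2 * (X * (F * N)))) := by
    refine ((vN.mul_left F').sub (vN'.mul_left F)).eq_of_eulerOp ?_
    rw [map_sub, coeffwise_eulerOp_mul, coeffwise_eulerOp_mul,
      h.eulerOp_left, h.eulerOp_left_deriv, dN, dN']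
    ring
  have e4 : F' * N' = coeffwise intX (F' * G - F') + coeffwise intY (X * (F' * N - F * N')) := by
    refine (vN'.mul_left F').eq_of_eulerOp ?_
    rw [coeffwise_eulerOp_mul, h.eulerOp_left_deriv, dN']
    ring
  have e5 := congrArg (fun f => coeffwise intX (coeffwise intX f)) h.intX_left_deriv_mul
  rw [e3] at e4
  rw [e2, e4] at e1
  simp only [map_add, map_sub, map_neg, coeffwise_two_mul, coeffwise_X_mul,
    coeffwise_intX_one] at e1 e5 ⊢
  linear_combination e1 + e5

end IsShufflePair

/-! ### The coefficients of the product series -/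

theorem repeatList_zero (w : List ℕ) : repeatList w 0 = [] := rfl

theorem repeatList_succ (w : List ℕ) (p : ℕ) : repeatList w (p + 1) = w ++ repeatList w p := by
  simp [repeatList, List.replicate_succ]

/-- The generating series of the polylogarithms of `{2}_i`. -/
noncomputable def twosSeries : ℝ⟦X⟧⟦X⟧ :=
  PowerSeries.mk fun i => polylogSeries (repeatList [2] i)

/-- The generating series of the polylogarithms of `{2}_i` at `-z`. -/
noncomputable def altTwosSeries : ℝ⟦X⟧⟦X⟧ :=
  PowerSeries.mk fun i => (-1 : ℝ) ^ i • polylogSeries (repeatList [2] i)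

/-- The sum of the polylogarithms of all lists obtained from `{2}_{k-1}` by inserting one entry
`4`; it is `0` for `k = 0`. -/
noncomputable def insertFour (k : ℕ) : ℝ⟦X⟧ :=
  ∑ a ∈ Finset.range k, polylogSeries (repeatList [2] a ++ 4 :: repeatList [2] (k - 1 - a))

/-- The generating series of `insertFour`. -/
noncomputable def insertFourSeries : ℝ⟦X⟧⟦X⟧ := PowerSeries.mk insertFour

theorem polylogSeries_nil : polylogSeries [] = 1 := rfl

theorem intX_intY_polylogSeries (l : List ℕ) :
    intX (intY (polylogSeries l)) = polylogSeries (2 :: l) := by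
  rw [intY_polylogSeries, intX_polylogSeries]

theorem insertFour_succ (k : ℕ) :
    insertFour (k + 1) =
      intX (intY (insertFour k)) + polylogSeries (4 :: repeatList [2] k) := by
  rw [insertFour, Finset.sum_range_succ', insertFour, map_sum, map_sum]
  congr 1
  refine Finset.sum_congr rfl fun a ha => ?_
  rw [intX_intY_polylogSeries, repeatList_succ]
  have : k + 1 - 1 - (a + 1) = k - 1 - a := by omega
  rw [this]
  rfl

theorem isShufflePair_twosSeries :
    IsShufflePair altTwosSeries (-(X * coeffwise intY altTwosSeries)) twosSeries
      (X * coeffwise intY twosSeries) where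
  left := by
    ext1 i
    cases i with
    | zero =>
      rw [map_add, coeff_coeffwise, map_neg, coeff_zero_X_mul]
      simp [altTwosSeries, repeatList_zero, polylogSeries_nil]
    | succ i =>
      rw [map_add, coeff_coeffwise, map_neg, coeff_succ_X_mul, coeff_coeffwise, coeff_one,
        if_neg i.succ_ne_zero, zero_add]
      simp only [altTwosSeries, coeff_mk, map_smul, map_neg, intX_intY_polylogSeries,
        repeatList_succ, List.singleton_append]
      rw [pow_succ]
      module
  left_deriv := rfl
  right := by
    ext1 i
    cases i with
    | zero =>
      rw [map_add, coeff_coeffwise, coeff_zero_X_mul]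
      simp [twosSeries, repeatList_zero, polylogSeries_nil]
    | succ i =>
      rw [map_add, coeff_coeffwise, coeff_succ_X_mul, coeff_coeffwise, coeff_one,
        if_neg i.succ_ne_zero, zero_add]
      simp only [twosSeries, coeff_mk, intX_intY_polylogSeries,
        repeatList_succ, List.singleton_append]
  right_deriv := rfl

theorem insertFourSeries_eq :
    insertFourSeries = coeffwise intX
      (X * coeffwise intY insertFourSeries + coeffwise intX (twosSeries - 1)) := by
  ext1 i
  rw [coeff_coeffwise, map_add, coeff_coeffwise, map_sub]
  cases i with
  | zero => simp [insertFourSeries, insertFour, twosSeries, repeatList_zero, polylogSeries_nil]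
  | succ i =>
    rw [coeff_succ_X_mul, coeff_coeffwise, coeff_one, if_neg i.succ_ne_zero, sub_zero]
    simp only [insertFourSeries, coeff_mk, insertFour_succ, twosSeries, map_add,
      repeatList_succ, List.singleton_append, intX_polylogSeries]

theorem coeff_two_mul (i : ℕ) (f : ℝ⟦X⟧⟦X⟧) : coeff i (2 * f) = (2 : ℝ) • coeff i f := by
  rw [two_mul, map_add, two_smul]

theorem coeff_three_mul (i : ℕ) (f : ℝ⟦X⟧⟦X⟧) : coeff i (3 * f) = (3 : ℝ) • coeff i f := by
  rw [show (3 : ℝ⟦X⟧⟦X⟧) * f = 2 * f + f by ring, map_add, coeff_two_mul]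
  module

theorem coeff_four_mul (i : ℕ) (f : ℝ⟦X⟧⟦X⟧) : coeff i (4 * f) = (4 : ℝ) • coeff i f := by
  rw [show (4 : ℝ⟦X⟧⟦X⟧) * f = 2 * (2 * f) by ring, coeff_two_mul, coeff_two_mul]
  module

/-- The coefficients of the product of the two generating series of `{2}_i` are the
polylogarithms of `{3,1}_n`, in even degree. -/
theorem coeff_altTwos_mul_twos (n : ℕ) :
    coeff (2 * n) (altTwosSeries * twosSeries) =
      (-4 : ℝ) ^ n • polylogSeries (repeatList [3, 1] n) ∧
    coeff (2 * n + 1) (altTwosSeries * twosSeries) = 0 := by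
  have e := isShufflePair_twosSeries.mul_eq
  set P := altTwosSeries * twosSeries
  have step : ∀ i, coeff (i + 2) P =
      -((4 : ℝ) • intX (intX (intY (intY (coeff i P))))) := fun i => by
    conv_lhs => rw [e]
    rw [map_sub, coeff_four_mul, coeff_one, if_neg (by omega), coeff_X_pow_mul]
    simp only [coeff_coeffwise, zero_sub]
  induction n with
  | zero =>
    constructor
    · rw [e, map_sub, coeff_four_mul, coeff_X_pow_mul']
      simp [repeatList_zero, polylogSeries_nil]
    · rw [e, map_sub, coeff_four_mul, coeff_X_pow_mul']
      simp [coeff_one]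
  | succ n ih =>
    constructor
    · rw [show 2 * (n + 1) = 2 * n + 2 by ring, step, ih.1, repeatList_succ]
      simp only [map_smul, intY_polylogSeries, intX_polylogSeries, List.cons_append,
        List.nil_append]
      rw [pow_succ]
      module
    · rw [show 2 * (n + 1) + 1 = 2 * n + 1 + 2 by ring, step, ih.2]
      simp

/-- The sum `∑_{p<n} (-4)^p c(n-p) Li({3,1}_p, A(n-p))`, the general shape of the sums in the
theorem. -/
noncomputable def prefixSum (c : ℕ → ℝ) (A : ℕ → List ℕ) (n : ℕ) : ℝ⟦X⟧ :=
  ∑ p ∈ Finset.range n,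
    ((-4) ^ p * c (n - p)) • polylogSeries (repeatList [3, 1] p ++ A (n - p))

/-- Splitting off `p = 0` turns the prefix `{3,1}` of the other terms into the operator
`xxyy`. -/
theorem prefixSum_succ (c : ℕ → ℝ) (A : ℕ → List ℕ) (n : ℕ) :
    prefixSum c A (n + 1) = c (n + 1) • polylogSeries (A (n + 1)) -
      (4 : ℝ) • intX (intX (intY (intY (prefixSum c A n)))) := by
  rw [prefixSum, Finset.sum_range_succ', prefixSum]
  simp only [map_sum, Finset.smul_sum, repeatList_zero, List.nil_append, Nat.sub_zero, pow_zero,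
    one_mul]
  rw [sub_eq_add_neg, add_comm, ← Finset.sum_neg_distrib]
  congr 1
  refine Finset.sum_congr rfl fun p _ => ?_
  simp only [map_smul, intY_polylogSeries, intX_polylogSeries, repeatList_succ, List.cons_append,
    List.nil_append, Nat.add_sub_add_right]
  rw [pow_succ]
  module

theorem coeff_altTwos_mul_insertFour_add_two (i : ℕ) :
    coeff (i + 2) (altTwosSeries * insertFourSeries) =
      -((4 : ℝ) • intX (intX (intY (intY (coeff i (altTwosSeries * insertFourSeries)))))) +
      (2 : ℝ) • intX (intX (coeff (i + 2) (altTwosSeries * twosSeries))) -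
      (3 : ℝ) • intX (intX (coeff (i + 2) altTwosSeries)) -
      (2 : ℝ) • intX (intX (intY (intX (coeff (i + 1) (altTwosSeries * twosSeries))))) +
      (2 : ℝ) • intX (intX (intY (intX (coeff (i + 1) altTwosSeries)))) -
      (2 : ℝ) • intX (intX (intX (intY (coeff (i + 1) (altTwosSeries * twosSeries))))) := by
  conv_lhs => rw [isShufflePair_twosSeries.mul_insertion_eq insertFourSeries_eq rfl]
  simp only [map_add, map_sub, map_neg, coeff_two_mul, coeff_three_mul, coeff_four_mul,
    coeff_X_pow_mul, coeff_succ_X_mul, coeff_coeffwise]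
  simp [coeff_one]

theorem coeff_altTwosSeries (i : ℕ) :
    coeff i altTwosSeries = (-1 : ℝ) ^ i • polylogSeries (repeatList [2] i) := by
  simp [altTwosSeries]

/-- The even coefficients of the product series satisfy the same recursion in `n` as the right-hand
side of the weight `4n+2` identity, read with polylogarithms. -/
theorem coeff_even_altTwos_mul_insertFour (n : ℕ) :
    coeff (2 * n) (altTwosSeries * insertFourSeries) =
      -(2 : ℝ) • prefixSum (fun _ => 1) (fun m => [3, 3] ++ repeatList [2] (2 * (m - 1))) n -
      (3 : ℝ) • prefixSum (fun _ => 1) (fun m => [4] ++ repeatList [2] (2 * m - 1)) n +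
      (2 : ℝ) • prefixSum (fun m => (-4) ^ m)
        (fun m => [5, 1] ++ repeatList [3, 1] (m - 1)) n := by
  induction n with
  | zero =>
    simp [coeff_mul, insertFourSeries, insertFour, prefixSum]
  | succ n ih =>
    rw [show 2 * (n + 1) = 2 * n + 2 by ring, coeff_altTwos_mul_insertFour_add_two, ih,
      (coeff_altTwos_mul_twos n).2, show 2 * n + 2 = 2 * (n + 1) by ring,
      (coeff_altTwos_mul_twos (n + 1)).1, coeff_altTwosSeries, coeff_altTwosSeries,
      prefixSum_succ, prefixSum_succ, prefixSum_succ]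
    have e1 : repeatList [2] (2 * (n + 1)) = 2 :: repeatList [2] (2 * n + 1) := repeatList_succ _ _
    have e2 : repeatList [2] (2 * n + 1) = 2 :: repeatList [2] (2 * n) := repeatList_succ _ _
    have e3 : 2 * (n + 1) - 1 = 2 * n + 1 := by omega
    have e4 : (-1 : ℝ) ^ (2 * (n + 1)) = 1 := by simp
    have e5 : (-1 : ℝ) ^ (2 * n + 1) = -1 := by rw [pow_succ, pow_mul]; simp
    rw [e1, e3, e4, e5]
    nth_rewrite 2 [e2]
    simp only [map_add, map_sub, map_smul, map_zero, intX_polylogSeries, intY_polylogSeries,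
      repeatList_succ, List.cons_append, List.nil_append, Nat.add_sub_cancel]
    module

/-- The odd coefficients of the product series are the right-hand side of the weight `4n+4`
identity, read with polylogarithms. -/
theorem coeff_odd_altTwos_mul_insertFour (n : ℕ) :
    coeff (2 * n + 1) (altTwosSeries * insertFourSeries) =
      (2 : ℝ) • prefixSum (fun _ => 1) (fun m => [3, 3] ++ repeatList [2] (2 * m - 1)) n +
      (3 : ℝ) • prefixSum (fun _ => 1) (fun m => [4] ++ repeatList [2] (2 * (m - 1))) (n + 1) -
      (2 : ℝ) • prefixSum (fun m => (-4) ^ m)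
        (fun m => [3, 4, 1] ++ repeatList [3, 1] (m - 1)) n -
      (2 : ℝ) • prefixSum (fun m => (-4) ^ (m - 1))
        (fun m => [4] ++ repeatList [3, 1] (m - 1)) (n + 1) := by
  induction n with
  | zero =>
    simp only [coeff_mul, Finset.Nat.antidiagonal_succ]
    simp [insertFourSeries, insertFour, prefixSum, repeatList_zero, altTwosSeries,
      polylogSeries_nil]
    module
  | succ n ih =>
    rw [show 2 * (n + 1) + 1 = 2 * n + 1 + 2 by ring, coeff_altTwos_mul_insertFour_add_two, ih,
      show 2 * n + 1 + 2 = 2 * (n + 1) + 1 by ring, (coeff_altTwos_mul_twos (n + 1)).2,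
      show 2 * n + 1 + 1 = 2 * (n + 1) by ring,
      (coeff_altTwos_mul_twos (n + 1)).1, coeff_altTwosSeries, coeff_altTwosSeries,
      prefixSum_succ _ (fun m => [3, 3] ++ repeatList [2] (2 * m - 1)) n,
      prefixSum_succ _ (fun m => [4] ++ repeatList [2] (2 * (m - 1))) (n + 1),
      prefixSum_succ _ (fun m => [3, 4, 1] ++ repeatList [3, 1] (m - 1)) n,
      prefixSum_succ _ (fun m => [4] ++ repeatList [3, 1] (m - 1)) (n + 1)]
    have e1 : repeatList [2] (2 * (n + 1) + 1) = 2 :: repeatList [2] (2 * (n + 1)) :=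
      repeatList_succ _ _
    have e2 : repeatList [2] (2 * (n + 1)) = 2 :: repeatList [2] (2 * n + 1) := repeatList_succ _ _
    have e3 : 2 * (n + 1) - 1 = 2 * n + 1 := by omega
    have e4 : (-1 : ℝ) ^ (2 * (n + 1)) = 1 := by simp
    have e5 : (-1 : ℝ) ^ (2 * (n + 1) + 1) = -1 := by rw [pow_succ, e4]; simp
    rw [e1, e3, e4, e5]
    nth_rewrite 2 [e2]
    simp only [map_add, map_sub, map_smul, map_zero, intX_polylogSeries, intY_polylogSeries,
      repeatList_succ, List.cons_append, List.nil_append, Nat.add_sub_cancel]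
    module

/-! ### Multiple zeta values as values at `t = 1` -/

/-- The largest entry `m₁` of an index, and `0` for the empty index. -/
def MZVIndex.head {d : ℕ} (m : MZVIndex d) : ℕ := if h : 0 < d then m.1 ⟨0, h⟩ else 0

/-- Prepend a new largest entry to an index. -/
def MZVIndex.cons {d : ℕ} (n : ℕ) (m : MZVIndex d) (h : m.head < n) : MZVIndex (d + 1) :=
  ⟨Fin.cons n m.1, by
    constructor
    · rw [Fin.strictAnti_iff_succ_lt]
      intro i
      cases d with
      | zero => exact i.elim0
      | succ d =>
        induction i using Fin.cases with
        | zero => simpa [head] using h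
        | succ i => simpa using m.2.1 (Fin.castSucc_lt_succ (i := i))
    · intro i
      induction i using Fin.cases with
      | zero => simpa using lt_of_le_of_lt (Nat.zero_le _) h
      | succ i => simpa using m.2.2 i⟩

theorem MZVIndex.head_cons {d : ℕ} (n : ℕ) (m : MZVIndex d) (h : m.head < n) :
    (m.cons n h).head = n := by
  simp [cons, head]

theorem MZVIndex.exists_eq_cons {d : ℕ} (m : MZVIndex (d + 1)) :
    ∃ (m' : MZVIndex d) (h : m'.head < m.head), m = m'.cons m.head h := by
  refine ⟨⟨fun i => m.1 i.succ, fun i j hij => m.2.1 (Fin.succ_lt_succ_iff.2 hij),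
    fun i => m.2.2 _⟩, ?_, ?_⟩
  · rw [head, head, dif_pos d.succ_pos]
    split_ifs with h
    · exact m.2.1 (by simp [Fin.lt_def])
    · exact m.2.2 _
  · apply Subtype.ext
    funext i
    induction i using Fin.cases with
    | zero => simp [cons, head]
    | succ i => simp [cons]

theorem mzvTerm_cons (k : ℕ) (l : List ℕ) (n : ℕ) (m : MZVIndex l.length) (h : m.head < n) :
    mzvTerm (k :: l) (m.cons n h) = mzvTerm l m / (n : ℝ) ^ k := by
  rw [mzvTerm, mzvTerm, div_div, one_div, one_div, inv_inj]
  refine (Fin.prod_univ_succ (n := l.length) _).trans ?_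
  rw [mul_comm]
  rfl

/-- The coefficient of `tⁿ` in the polylogarithm collects the terms of the multiple zeta series
with `m₁ = n`. -/
theorem hasSum_head_eq (k : List ℕ) (n : ℕ) :
    HasSum (fun m : MZVIndex k.length => if m.head = n then mzvTerm k m else 0)
      (coeff n (polylogSeries k)) := by
  induction k generalizing n with
  | nil =>
    have : Unique (MZVIndex ([] : List ℕ).length) :=
      ⟨⟨⟨Fin.elim0, fun i => i.elim0, fun i => i.elim0⟩⟩,
        fun m => Subtype.ext (funext fun i => i.elim0)⟩
    convert! hasSum_unique (fun m : MZVIndex ([] : List ℕ).length =>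
      if m.head = n then mzvTerm [] m else 0) using 1
    simp only [polylogSeries_nil, coeff_one, MZVIndex.head, mzvTerm, List.length_nil, lt_irrefl,
      dite_false, eq_comm (a := n)]
    simp
  | cons k l ih =>
    have hinj : Function.Injective (fun m : {m : MZVIndex l.length | m.head < n} =>
        (m.1.cons n m.2 : MZVIndex (l.length + 1))) := by
      intro a b hab
      exact Subtype.ext (Subtype.ext
        (congrArg (fun (m : MZVIndex (l.length + 1)) (i : Fin l.length) => m.1 i.succ) hab))
    refine (hinj.hasSum_iff (f := fun m : MZVIndex (k :: l).length =>
      if m.head = n then mzvTerm (k :: l) m else 0) ?_).1 ?_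
    · intro m hm
      rw [if_neg]
      rintro rfl
      obtain ⟨m', h, e⟩ := MZVIndex.exists_eq_cons m
      exact hm ⟨⟨m', h⟩, e.symm⟩
    · have e : ((fun m : MZVIndex (k :: l).length =>
          if m.head = n then mzvTerm (k :: l) m else 0) ∘
          (fun m : {m : MZVIndex l.length | m.head < n} =>
            (m.1.cons n m.2 : MZVIndex (l.length + 1)))) =
          (fun m : MZVIndex l.length => mzvTerm l m / (n : ℝ) ^ k) ∘ Subtype.val := by
        funext m
        exact (if_pos (MZVIndex.head_cons n m.1 m.2)).trans (mzvTerm_cons k l n m.1 m.2)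
      rw [e]
      refine hasSum_subtype_iff_indicator.2 ?_
      rw [coeff_polylogSeries_cons]
      have hs := (hasSum_sum (s := Finset.range n) fun j _ => ih j).div_const ((n : ℝ) ^ k)
      refine hs.congr_fun ?_
      intro m
      rw [Finset.sum_ite_eq]
      by_cases hm : m.head < n <;> simp [Set.indicator, hm]

/-- The index lists whose multiple zeta series converges: all entries are at least `1`, the first
one is at least `2`. The empty list is included. -/
def Admissible : List ℕ → Prop
  | [] => True
  | a :: l => 2 ≤ a ∧ ∀ b ∈ l, 1 ≤ b

theorem Admissible.one_le {l : List ℕ} (h : Admissible l) : ∀ b ∈ l, 1 ≤ b := by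
  cases l with
  | nil => simp
  | cons a l => exact List.forall_mem_cons.2 ⟨one_le_two.trans h.1, h.2⟩

theorem Admissible.append {l r : List ℕ} (hl : Admissible l) (hr : Admissible r) :
    Admissible (l ++ r) := by
  cases l with
  | nil => exact hr
  | cons a l => exact ⟨hl.1, fun b hb => (List.mem_append.1 hb).elim (hl.2 b) (hr.one_le b)⟩

theorem Admissible.repeatList {w : List ℕ} (hw : Admissible w) (p : ℕ) :
    Admissible (repeatList w p) := by
  induction p with
  | zero => trivial
  | succ p ih => rw [repeatList_succ]; exact hw.append ih

/-- The coefficients of the series sum to `a`, that is, the series has the value `a` at `t = 1`. -/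
def HasValue (f : ℝ⟦X⟧) (a : ℝ) : Prop := HasSum (fun n => coeff n f) a

theorem Admissible.hasValue {k : List ℕ} (hk : Admissible k) :
    HasValue (polylogSeries k) (multiZeta k) := by
  have hs : Summable (mzvTerm k) := by
    cases k with
    | nil =>
      have : Subsingleton (MZVIndex ([] : List ℕ).length) :=
        ⟨fun a b => Subtype.ext (funext fun i => i.elim0)⟩
      exact Summable.of_finite
    | cons a l => exact summable_mzvTerm a l hk.1 hk.2
  refine HasSum.sigma ((Equiv.sigmaFiberEquiv MZVIndex.head).hasSum_iff.2 hs.hasSum) fun n => ?_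
  have := hasSum_head_eq k n
  refine (hasSum_subtype_iff_indicator (s := {m : MZVIndex k.length | m.head = n})).2
    (this.congr_fun fun m => ?_)
  simp [Set.indicator]

theorem HasValue.add {f g : ℝ⟦X⟧} {a b : ℝ} (hf : HasValue f a) (hg : HasValue g b) :
    HasValue (f + g) (a + b) := by
  simpa [HasValue] using HasSum.add hf hg

theorem HasValue.smul {f : ℝ⟦X⟧} {a : ℝ} (c : ℝ) (hf : HasValue f a) :
    HasValue (c • f) (c * a) := by
  simpa [HasValue] using HasSum.mul_left c hf

theorem HasValue.sub {f g : ℝ⟦X⟧} {a b : ℝ} (hf : HasValue f a) (hg : HasValue g b) :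
    HasValue (f - g) (a - b) := by
  simpa [HasValue] using HasSum.sub hf hg

theorem HasValue.sum {ι : Type*} (s : Finset ι) {f : ι → ℝ⟦X⟧} {a : ι → ℝ}
    (h : ∀ i ∈ s, HasValue (f i) (a i)) : HasValue (∑ i ∈ s, f i) (∑ i ∈ s, a i) := by
  simpa [HasValue] using hasSum_sum h

/-- Cauchy product: evaluation at `t = 1` is multiplicative. -/
theorem HasValue.mul {f g : ℝ⟦X⟧} {a b : ℝ} (hf : HasValue f a) (hg : HasValue g b) :
    HasValue (f * g) (a * b) := by
  have hf' : Summable fun n => ‖coeff n f‖ := hf.summable.norm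
  have hg' : Summable fun n => ‖coeff n g‖ := hg.summable.norm
  have hs := (summable_norm_sum_mul_antidiagonal_of_summable_norm hf' hg').of_norm.hasSum
  rw [← tsum_mul_tsum_eq_tsum_sum_antidiagonal_of_summable_norm hf' hg', HasSum.tsum_eq hf,
    HasSum.tsum_eq hg] at hs
  simpa only [HasValue, coeff_mul] using hs

theorem hasValue_prefixSum (c : ℕ → ℝ) (A : ℕ → List ℕ) (hA : ∀ m, Admissible (A m)) (n : ℕ) :
    HasValue (prefixSum c A n) (∑ p ∈ Finset.range n,
      ((-4) ^ p * c (n - p)) * multiZeta (repeatList [3, 1] p ++ A (n - p))) :=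
  HasValue.sum _ fun p _ => HasValue.smul _ <| Admissible.hasValue <|
    (Admissible.repeatList (by simp [Admissible]) p).append (hA _)

/-! ### Truncated generating series as finite products -/

/-- The sum of the coefficients of degree less than `N`. -/
noncomputable def partialValue (N : ℕ) : ℝ⟦X⟧ →ₗ[ℝ] ℝ where
  toFun f := ∑ j ∈ Finset.range N, coeff j f
  map_add' f g := by simp [Finset.sum_add_distrib]
  map_smul' c f := by simp [Finset.mul_sum]

theorem partialValue_apply (N : ℕ) (f : ℝ⟦X⟧) :
    partialValue N f = ∑ j ∈ Finset.range N, coeff j f := rfl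

theorem HasValue.tendsto_partialValue {f : ℝ⟦X⟧} {a : ℝ} (h : HasValue f a) :
    Tendsto (fun N => partialValue N f) atTop (𝓝 a) :=
  HasSum.tendsto_sum_nat h

theorem partialValue_succ_intX_intY (N : ℕ) (f : ℝ⟦X⟧) :
    partialValue (N + 1) (intX (intY f)) =
      partialValue N (intX (intY f)) + partialValue N f / (N : ℝ) ^ 2 := by
  rw [partialValue_apply, partialValue_apply, partialValue_apply, Finset.sum_range_succ,
    coeff_intX, coeff_intY, div_div, sq]

theorem partialValue_succ_polylogSeries (N k : ℕ) (l : List ℕ) :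
    partialValue (N + 1) (polylogSeries (k :: l)) =
      partialValue N (polylogSeries (k :: l)) + partialValue N (polylogSeries l) / (N : ℝ) ^ k := by
  rw [partialValue_apply, partialValue_apply, partialValue_apply, Finset.sum_range_succ,
    coeff_polylogSeries_cons]

/-- The generating series of the truncations to `m₁ ≤ N` of `ζ({2}_i)`. -/
noncomputable def twosPartial (N : ℕ) : ℝ⟦X⟧ :=
  PowerSeries.mk fun i => partialValue (N + 1) (polylogSeries (repeatList [2] i))

/-- The generating series of the truncations to `m₁ ≤ N` of the values of `insertFour`. -/
noncomputable def insertFourPartial (N : ℕ) : ℝ⟦X⟧ :=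
  PowerSeries.mk fun i => partialValue (N + 1) (insertFour i)

theorem partialValue_succ_one (N : ℕ) : partialValue (N + 1) 1 = 1 := by
  simp [partialValue_apply, coeff_one]

theorem twosPartial_zero : twosPartial 0 = 1 := by
  ext i
  rw [twosPartial, coeff_mk]
  cases i with
  | zero => simp [repeatList_zero, polylogSeries_nil, partialValue_succ_one]
  | succ i =>
    rw [repeatList_succ, coeff_one, if_neg i.succ_ne_zero, zero_add, partialValue_apply,
      Finset.sum_range_one]
    exact coeff_zero_polylogSeries_cons _ _

/-- This recursion gives `twosPartial N = ∏_{1 ≤ m ≤ N} (1 + z / m²)`. -/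
theorem twosPartial_succ (N : ℕ) :
    twosPartial (N + 1) = (1 + C (1 / ((N : ℝ) + 1) ^ 2) * X) * twosPartial N := by
  ext i
  rw [add_mul, one_mul, mul_assoc, map_add, coeff_C_mul]
  cases i with
  | zero => simp [twosPartial, repeatList_zero, polylogSeries_nil, partialValue_succ_one]
  | succ i =>
    rw [coeff_succ_X_mul]
    simp only [twosPartial, coeff_mk, repeatList_succ, List.singleton_append]
    rw [partialValue_succ_polylogSeries (N + 1)]
    push_cast
    ring

theorem insertFourPartial_zero : insertFourPartial 0 = 0 := by
  ext i
  simp only [insertFourPartial, coeff_mk, map_zero]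
  cases i with
  | zero => simp [insertFour]
  | succ i =>
    rw [insertFour_succ, zero_add, partialValue_apply, Finset.sum_range_one, map_add,
      coeff_zero_intX, coeff_zero_polylogSeries_cons, add_zero]

theorem insertFourPartial_succ (N : ℕ) :
    insertFourPartial (N + 1) = (1 + C (1 / ((N : ℝ) + 1) ^ 2) * X) * insertFourPartial N +
      C (1 / ((N : ℝ) + 1) ^ 4) * X * twosPartial N := by
  ext i
  rw [add_mul, one_mul, mul_assoc, mul_assoc, map_add, map_add, coeff_C_mul, coeff_C_mul]
  cases i with
  | zero => simp [insertFourPartial, insertFour]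
  | succ i =>
    rw [coeff_succ_X_mul, coeff_succ_X_mul]
    simp only [insertFourPartial, twosPartial, coeff_mk, insertFour_succ, map_add]
    rw [partialValue_succ_polylogSeries (N + 1), partialValue_succ_intX_intY (N + 1)]
    push_cast
    ring

theorem evalNegHom_C (a : ℝ) : evalNegHom (C a : ℝ⟦X⟧) = C a := by
  ext i
  rw [evalNegHom, coeff_rescale, coeff_C]
  split_ifs with h <;> simp [h]

theorem evalNegHom_one_add (a : ℝ) :
    evalNegHom (1 + C a * X) = 1 - C a * (X : ℝ⟦X⟧) := by
  rw [map_add, map_one, map_mul, evalNegHom_X, evalNegHom_C]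
  ring

/-- The product `∏_{1 ≤ m ≤ N} (1 - z² / m⁴)`. -/
noncomputable def foursPartial (N : ℕ) : ℝ⟦X⟧ := evalNegHom (twosPartial N) * twosPartial N

theorem foursPartial_zero : foursPartial 0 = 1 := by
  simp [foursPartial, twosPartial_zero]

theorem foursPartial_succ (N : ℕ) :
    foursPartial (N + 1) =
      (1 - C (1 / ((N : ℝ) + 1) ^ 2) * X) * (1 + C (1 / ((N : ℝ) + 1) ^ 2) * X) *
        foursPartial N := by
  rw [foursPartial, twosPartial_succ, map_mul, evalNegHom_one_add, foursPartial]
  ring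

/-- The series of `a² / (1 + a z)`. -/
noncomputable def geomTerm (a : ℝ) : ℝ⟦X⟧ := PowerSeries.mk fun k => (-1) ^ k * a ^ (k + 2)

theorem one_add_mul_geomTerm (a : ℝ) : (1 + C a * X) * geomTerm a = C (a ^ 2) := by
  ext k
  rw [add_mul, one_mul, mul_assoc, map_add, coeff_C_mul, coeff_C]
  cases k with
  | zero => simp [geomTerm]
  | succ k =>
    rw [coeff_succ_X_mul, if_neg k.succ_ne_zero]
    simp only [geomTerm, coeff_mk]
    ring

theorem one_sub_mul_evalNegHom_geomTerm (a : ℝ) :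
    (1 - C a * X) * evalNegHom (geomTerm a) = C (a ^ 2) := by
  rw [← evalNegHom_one_add, ← map_mul, one_add_mul_geomTerm, evalNegHom_C]

/-- The generating series `∑_k (-1)ᵏ zᵏ ∑_{1 ≤ m ≤ N} m ^ (-2k-4)` of truncated zeta values. -/
noncomputable def powerSumPartial (N : ℕ) : ℝ⟦X⟧ :=
  ∑ j ∈ Finset.range N, geomTerm (1 / ((j : ℝ) + 1) ^ 2)

theorem powerSumPartial_succ (N : ℕ) :
    powerSumPartial (N + 1) = powerSumPartial N + geomTerm (1 / ((N : ℝ) + 1) ^ 2) :=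
  Finset.sum_range_succ _ _

/-- Inserting a `4` into `{2}_k` amounts to replacing one factor `1 + z/m²` of the product by
`z/m⁴`, which is multiplication by `∑_m (z/m⁴) / (1 + z/m²)`. -/
theorem evalNegHom_twosPartial_mul_insertFourPartial (N : ℕ) :
    evalNegHom (twosPartial N) * insertFourPartial N =
      X * (foursPartial N * powerSumPartial N) := by
  induction N with
  | zero => simp [insertFourPartial_zero, powerSumPartial]
  | succ N ih =>
    rw [foursPartial_succ, powerSumPartial_succ, twosPartial_succ, insertFourPartial_succ, map_mul,
      evalNegHom_one_add]
    have e := one_add_mul_geomTerm (1 / ((N : ℝ) + 1) ^ 2)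
    rw [div_pow, one_pow, ← pow_mul] at e
    norm_num only at e
    set q : ℝ⟦X⟧ := C (1 / ((N : ℝ) + 1) ^ 2) * X
    rw [foursPartial] at ih ⊢
    linear_combination (1 - q) * (1 + q) * ih -
      X * (1 - q) * evalNegHom (twosPartial N) * twosPartial N * e

/-- The logarithmic derivative of `∏ (1 - z² / m⁴)`: Newton's identities. -/
theorem X_mul_derivative_foursPartial (N : ℕ) :
    X * derivative ℝ (foursPartial N) =
      -(X ^ 2 * (foursPartial N * (powerSumPartial N + evalNegHom (powerSumPartial N)))) := by
  induction N with
  | zero => simp [foursPartial_zero, powerSumPartial]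
  | succ N ih =>
    have e := one_add_mul_geomTerm (1 / ((N : ℝ) + 1) ^ 2)
    have e' := one_sub_mul_evalNegHom_geomTerm (1 / ((N : ℝ) + 1) ^ 2)
    rw [foursPartial_succ, powerSumPartial_succ, map_add]
    set a := 1 / ((N : ℝ) + 1) ^ 2
    have hd : derivative ℝ ((1 - C a * X) * (1 + C a * X) * foursPartial N) =
        (1 - C a * X) * (1 + C a * X) * derivative ℝ (foursPartial N) -
          2 * C a ^ 2 * X * foursPartial N := by
      simp only [Derivation.leibniz, map_add, map_sub, smul_eq_mul, derivative_X, derivative_C,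
        Derivation.map_one_eq_zero]
      ring
    rw [hd]
    rw [map_pow] at e e'
    linear_combination (1 - C a * X) * (1 + C a * X) * ih
      + X ^ 2 * foursPartial N * (1 - C a * X) * e + X ^ 2 * foursPartial N * (1 + C a * X) * e'

/-! ### Passage to the limit -/

/-- The generating series of `ζ({2}_i)`. -/
noncomputable def twosValue : ℝ⟦X⟧ := PowerSeries.mk fun i => multiZeta (repeatList [2] i)

/-- The generating series of the sums of `ζ({2}_a, 4, {2}_b)` over `a + b = k - 1`. -/
noncomputable def insertFourValue : ℝ⟦X⟧ := PowerSeries.mk fun k =>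
  ∑ a ∈ Finset.range k, multiZeta (repeatList [2] a ++ 4 :: repeatList [2] (k - 1 - a))

/-- The generating series of `(-1)ⁿ ζ({4}_n)` in `z²`, the limit of `foursPartial`. -/
noncomputable def foursValue : ℝ⟦X⟧ := evalNegHom twosValue * twosValue

/-- The generating series of `(-1)ᵏ ζ(2k + 4)`. -/
noncomputable def powerSumValue : ℝ⟦X⟧ :=
  PowerSeries.mk fun k => (-1) ^ k * ∑' j : ℕ, (1 / ((j : ℝ) + 1) ^ 2) ^ (k + 2)

theorem admissible_repeatList_two (i : ℕ) : Admissible (repeatList [2] i) :=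
  Admissible.repeatList (by simp [Admissible]) i

theorem hasValue_insertFour (k : ℕ) : HasValue (insertFour k) (coeff k insertFourValue) := by
  rw [insertFourValue, coeff_mk]
  exact HasValue.sum _ fun a _ => Admissible.hasValue <| (admissible_repeatList_two a).append
    ⟨by norm_num, (admissible_repeatList_two _).one_le⟩

theorem tendsto_evalNegHom {f : ℕ → ℝ⟦X⟧} {g : ℝ⟦X⟧} (h : Tendsto f atTop (𝓝 g)) :
    Tendsto (fun N => evalNegHom (f N)) atTop (𝓝 (evalNegHom g)) := by
  rw [WithPiTopology.tendsto_iff_coeff_tendsto] at h ⊢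
  intro d
  simp only [evalNegHom, coeff_rescale]
  exact (h d).const_mul _

theorem tendsto_twosPartial : Tendsto twosPartial atTop (𝓝 twosValue) := by
  rw [WithPiTopology.tendsto_iff_coeff_tendsto]
  intro d
  simp only [twosPartial, twosValue, coeff_mk]
  exact (admissible_repeatList_two d).hasValue.tendsto_partialValue.comp (tendsto_add_atTop_nat 1)

theorem tendsto_insertFourPartial : Tendsto insertFourPartial atTop (𝓝 insertFourValue) := by
  rw [WithPiTopology.tendsto_iff_coeff_tendsto]
  intro d
  simp only [insertFourPartial, coeff_mk]
  exact (hasValue_insertFour d).tendsto_partialValue.comp (tendsto_add_atTop_nat 1)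

theorem tendsto_foursPartial : Tendsto foursPartial atTop (𝓝 foursValue) :=
  (tendsto_evalNegHom tendsto_twosPartial).mul tendsto_twosPartial

theorem summable_one_div_succ_sq_pow (k : ℕ) :
    Summable fun j : ℕ => (1 / ((j : ℝ) + 1) ^ 2) ^ (k + 1) := by
  have h := (summable_nat_add_iff 1).2
    (Real.summable_one_div_nat_pow (p := 2 * (k + 1)).2 (by omega))
  refine h.congr fun j => ?_
  rw [div_pow, one_pow, ← pow_mul]
  push_cast
  rfl

theorem tendsto_powerSumPartial : Tendsto powerSumPartial atTop (𝓝 powerSumValue) := by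
  rw [WithPiTopology.tendsto_iff_coeff_tendsto]
  intro d
  simp only [powerSumPartial, powerSumValue, coeff_mk, map_sum, geomTerm]
  simp only [← Finset.mul_sum]
  exact (summable_one_div_succ_sq_pow (d + 1)).hasSum.tendsto_sum_nat.const_mul _

theorem evalNegHom_twosValue_mul_insertFourValue :
    evalNegHom twosValue * insertFourValue = X * (foursValue * powerSumValue) := by
  refine tendsto_nhds_unique
    ((tendsto_evalNegHom tendsto_twosPartial).mul tendsto_insertFourPartial) ?_
  simp only [evalNegHom_twosPartial_mul_insertFourPartial]
  exact (tendsto_foursPartial.mul tendsto_powerSumPartial).const_mul _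

theorem X_mul_derivative_foursValue :
    X * derivative ℝ foursValue =
      -(X ^ 2 * (foursValue * (powerSumValue + evalNegHom powerSumValue))) := by
  have h : Tendsto (fun N => X * derivative ℝ (foursPartial N)) atTop
      (𝓝 (X * derivative ℝ foursValue)) := by
    refine Tendsto.const_mul _ ?_
    have := tendsto_foursPartial
    rw [WithPiTopology.tendsto_iff_coeff_tendsto] at this ⊢
    intro d
    simp only [coeff_derivative]
    exact (this (d + 1)).mul_const _
  refine tendsto_nhds_unique h ?_
  simp only [X_mul_derivative_foursPartial]
  exact ((tendsto_foursPartial.mul (tendsto_powerSumPartial.add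
    (tendsto_evalNegHom tendsto_powerSumPartial))).const_mul _).neg

theorem evalNegHom_evalNegHom (f : ℝ⟦X⟧) : evalNegHom (evalNegHom f) = f := by
  ext i
  rw [evalNegHom, coeff_rescale, coeff_rescale, ← mul_assoc, ← mul_pow]
  simp

/-- Newton's identities in the limit. As `foursValue` is even in `z`, both summands on the right of
`X_mul_derivative_foursValue` contribute the same even coefficients. -/
theorem coeff_even_foursValue_mul_powerSumValue (n : ℕ) :
    coeff (2 * n) (foursValue * powerSumValue) =
      -((n + 1) * coeff (2 * (n + 1)) foursValue) := by
  have e := congrArg (coeff (2 * n + 2)) X_mul_derivative_foursValue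
  have hP : evalNegHom foursValue = foursValue := by
    rw [foursValue, map_mul, evalNegHom_evalNegHom, mul_comm]
  have hW : coeff (2 * n) (foursValue * evalNegHom powerSumValue) =
      coeff (2 * n) (foursValue * powerSumValue) := by
    conv_lhs => rw [← hP, ← map_mul, evalNegHom, coeff_rescale]
    simp
  rw [map_neg, coeff_X_pow_mul, mul_add, map_add, hW, coeff_succ_X_mul, coeff_derivative] at e
  push_cast at e
  rw [show 2 * (n + 1) = 2 * n + 1 + 1 by ring]
  linear_combination e / 2

/-- The value at `t = 1` of the product series, computed from the infinite products. -/
theorem hasValue_coeff_altTwos_mul_insertFour (i : ℕ) :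
    HasValue (coeff i (altTwosSeries * insertFourSeries))
      (coeff i (X * (foursValue * powerSumValue))) := by
  rw [← evalNegHom_twosValue_mul_insertFourValue, coeff_mul, coeff_mul]
  refine HasValue.sum _ fun p _ => HasValue.mul ?_ ?_
  · rw [coeff_altTwosSeries, evalNegHom, coeff_rescale, twosValue, coeff_mk]
    exact (admissible_repeatList_two _).hasValue.smul _
  · rw [insertFourSeries, coeff_mk]
    exact hasValue_insertFour _

/-! ### Explicit values -/

/-- A power series that vanishes on an interval `(0, δ)` has zero coefficients. -/
theorem eq_zero_of_hasSum_zero {d : ℕ → ℝ} {δ : ℝ} (hδ : 0 < δ)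
    (h : ∀ x, 0 < x → x < δ → HasSum (fun i => d i * x ^ i) 0) : d = 0 := by
  set p := FormalMultilinearSeries.ofScalars ℝ d
  have hr : 0 < p.radius := by
    have hs := (h (δ / 2) (by positivity) (by linarith)).summable.norm
    refine lt_of_lt_of_le ?_ (p.le_radius_of_summable (r := (δ / 2).toNNReal) ?_)
    · simpa using hδ
    · refine hs.congr fun i => ?_
      rw [FormalMultilinearSeries.ofScalars_norm, norm_mul, norm_pow,
        Real.norm_of_nonneg (show 0 ≤ δ / 2 by positivity), Real.coe_toNNReal _ (by positivity)]
  have hp := (p.hasFPowerSeriesOnBall hr).hasFPowerSeriesAt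
  have hz : ∃ᶠ x in 𝓝[≠] (0 : ℝ), p.sum x = 0 := by
    have : ∀ᶠ x in 𝓝[>] (0 : ℝ), p.sum x = 0 := by
      filter_upwards [Ioo_mem_nhdsGT hδ] with x hx
      have := (h x hx.1 hx.2).tsum_eq
      rw [← this]
      change FormalMultilinearSeries.ofScalarsSum d x = _
      rw [FormalMultilinearSeries.ofScalarsSum_eq_tsum]
      simp
    exact this.frequently.filter_mono (nhdsWithin_mono _ fun x hx => ne_of_gt hx)
  have h0 := hp.eq_zero_of_eventually (hp.analyticAt.frequently_zero_iff_eventually_zero.1 hz)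
  exact (FormalMultilinearSeries.ofScalars_series_eq_zero ℝ).1 h0

theorem hasSum_one_add_mul {f : ℝ⟦X⟧} {y a : ℝ} (q : ℝ)
    (h : HasSum (fun i => coeff i f * y ^ i) a) :
    HasSum (fun i => coeff i ((1 + C q * X) * f) * y ^ i) ((1 + q * y) * a) := by
  have h1 : HasSum (fun i => coeff i (X * f) * y ^ i) (y * a) := by
    rw [← hasSum_nat_add_iff' 1]
    simp only [Finset.sum_range_one, coeff_zero_X_mul, zero_mul, sub_zero, coeff_succ_X_mul]
    exact (h.mul_left y).congr_fun fun i => by ring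
  rw [show (1 + q * y) * a = a + q * (y * a) by ring]
  refine (h.add (h1.mul_left q)).congr_fun fun i => ?_
  rw [add_mul, one_mul, mul_assoc, map_add, coeff_C_mul]
  ring

theorem hasSum_twosPartial (N : ℕ) (y : ℝ) :
    HasSum (fun i => coeff i (twosPartial N) * y ^ i)
      (∏ j ∈ Finset.range N, (1 + 1 / ((j : ℝ) + 1) ^ 2 * y)) := by
  induction N with
  | zero =>
    rw [twosPartial_zero, Finset.prod_range_zero]
    have e : (fun i => coeff i (1 : ℝ⟦X⟧) * y ^ i) = fun i => if i = 0 then (1 : ℝ) else 0 := by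
      funext i
      rw [coeff_one]
      split_ifs with hi <;> simp [hi]
    rw [e]
    exact hasSum_ite_eq 0 1
  | succ N ih =>
    rw [twosPartial_succ, Finset.prod_range_succ,
      mul_comm (∏ j ∈ Finset.range N, (1 + 1 / ((j : ℝ) + 1) ^ 2 * y))]
    exact hasSum_one_add_mul _ ih

theorem coeff_twosPartial_nonneg_and_le (N i : ℕ) :
    0 ≤ coeff i (twosPartial N) ∧
      coeff i (twosPartial N) ≤ (∑ j ∈ Finset.range N, 1 / ((j : ℝ) + 1) ^ 2) ^ i := by
  induction N generalizing i with
  | zero =>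
    rw [twosPartial_zero, coeff_one]
    split_ifs with h <;> simp [h]
  | succ N ih =>
    rw [twosPartial_succ, add_mul, one_mul, mul_assoc, map_add, coeff_C_mul]
    cases i with
    | zero => simpa using ih 0
    | succ i =>
      rw [coeff_succ_X_mul, Finset.sum_range_succ]
      obtain ⟨h0, h1⟩ := ih (i + 1)
      obtain ⟨h2, h3⟩ := ih i
      set s := ∑ j ∈ Finset.range N, 1 / ((j : ℝ) + 1) ^ 2 with hs
      have hs0 : 0 ≤ s := Finset.sum_nonneg fun j _ => by positivity
      set q := 1 / ((N : ℝ) + 1) ^ 2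
      have hq : 0 ≤ q := by positivity
      refine ⟨by positivity, ?_⟩
      calc _ ≤ s ^ (i + 1) + q * s ^ i := by gcongr
        _ = (s + q) * s ^ i := by ring
        _ ≤ (s + q) * (s + q) ^ i := by gcongr; linarith
        _ = _ := by ring

theorem coeff_twosPartial_le (N i : ℕ) : coeff i (twosPartial N) ≤ 2 ^ i := by
  refine (coeff_twosPartial_nonneg_and_le N i).2.trans ?_
  gcongr
  have h := (hasSum_nat_add_iff' 1).2 hasSum_zeta_two
  have h1 := sum_le_hasSum (Finset.range N) (fun j _ => by positivity) h
  have h2 : Real.pi ^ 2 < 12 := by nlinarith [Real.pi_lt_d2, Real.pi_pos]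
  simp only [Nat.cast_add, Nat.cast_one, Finset.sum_range_one, Nat.cast_zero] at h1
  norm_num at h1 ⊢
  linarith

theorem hasSum_twosValue {x : ℝ} (hx : 0 < x) (hx' : x < 1 / 4) :
    HasSum (fun i => coeff i twosValue * (-x) ^ i)
      (Real.sin (Real.pi * √x) / (Real.pi * √x)) := by
  -- Dominated convergence: the coefficients are at most `2 ^ i`, and `2 * x < 1 / 2`.
  have hb : Summable fun i : ℕ => (1 / 2 : ℝ) ^ i := summable_geometric_two
  have hbd : ∀ N i, ‖coeff i (twosPartial N) * (-x) ^ i‖ ≤ (1 / 2 : ℝ) ^ i := fun N i => by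
    rw [norm_mul, norm_pow, norm_neg, Real.norm_of_nonneg hx.le,
      Real.norm_of_nonneg (coeff_twosPartial_nonneg_and_le N i).1]
    calc _ ≤ (2 : ℝ) ^ i * (1 / 4) ^ i := by
          gcongr
          exact coeff_twosPartial_le N i
      _ = _ := by rw [← mul_pow]; norm_num
  have hcoeff : ∀ i, Tendsto (fun N => coeff i (twosPartial N) * (-x) ^ i) atTop
      (𝓝 (coeff i twosValue * (-x) ^ i)) := fun i => by
    simp only [twosPartial, twosValue, coeff_mk]
    exact ((admissible_repeatList_two i).hasValue.tendsto_partialValue.comp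
      (tendsto_add_atTop_nat 1)).mul_const _
  have hlim := tendsto_tsum_of_dominated_convergence hb hcoeff
    (Eventually.of_forall fun N i => hbd N i)
  have hsum : Summable fun i => coeff i twosValue * (-x) ^ i :=
    Summable.of_norm_bounded hb fun i =>
      le_of_tendsto (hcoeff i).norm (Eventually.of_forall fun N => hbd N i)
  have hs : 0 < √x := Real.sqrt_pos.2 hx
  have hpi := Real.pi_pos
  have hprod := (Real.tendsto_euler_sin_prod √x).div_const (Real.pi * √x)
  convert! hsum.hasSum using 1
  refine tendsto_nhds_unique hprod (hlim.congr fun N => ?_)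
  rw [(hasSum_twosPartial N (-x)).tsum_eq, mul_div_cancel_left₀ _ (by positivity)]
  refine Finset.prod_congr rfl fun j _ => ?_
  rw [Real.sq_sqrt hx.le]
  ring

/-- The value of `ζ({2}_i)`, by comparing coefficients in Euler's product
`sin (π √x) / (π √x) = ∏ (1 - x / m²)` for small `x > 0`. -/
theorem multiZeta_repeatList_two (i : ℕ) :
    multiZeta (repeatList [2] i) = Real.pi ^ (2 * i) / (Nat.factorial (2 * i + 1) : ℝ) := by
  have h : (fun i => (coeff i twosValue - Real.pi ^ (2 * i) / (Nat.factorial (2 * i + 1) : ℝ)) *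
      (-1) ^ i) = 0 := by
    refine eq_zero_of_hasSum_zero (δ := 1 / 4) (by norm_num) fun x hx hx' => ?_
    have hs : 0 < √x := Real.sqrt_pos.2 hx
    have hpi := Real.pi_pos
    have h1 := (Real.hasSum_sin (Real.pi * √x)).div_const (Real.pi * √x)
    rw [← sub_self (Real.sin (Real.pi * √x) / (Real.pi * √x))]
    refine ((hasSum_twosValue hx hx').sub h1).congr_fun fun i => ?_
    have e : (Real.pi * √x) ^ (2 * i + 1) = Real.pi ^ (2 * i) * x ^ i * (Real.pi * √x) := by
      rw [pow_succ, mul_pow, pow_mul √x, Real.sq_sqrt hx.le]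
    rw [e, neg_pow x]
    field_simp
  have hi := congrFun h i
  simp only [Pi.zero_apply, mul_eq_zero, pow_eq_zero_iff', neg_eq_zero, one_ne_zero, false_and,
    or_false, twosValue, coeff_mk] at hi
  linarith

theorem sum_range_two_mul {M : Type*} [AddCommMonoid M] (f : ℕ → M) (m : ℕ) :
    ∑ k ∈ Finset.range (2 * m), f k = ∑ a ∈ Finset.range m, (f (2 * a) + f (2 * a + 1)) := by
  induction m with
  | zero => simp
  | succ m ih =>
    rw [show 2 * (m + 1) = 2 * m + 1 + 1 by ring, Finset.sum_range_succ, Finset.sum_range_succ, ih,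
      Finset.sum_range_succ, add_assoc]

theorem sum_neg_one_pow_mul_choose_odd (m : ℕ) :
    ∑ a ∈ Finset.range (m + 1), (-1 : ℝ) ^ a * ((2 * m + 2).choose (2 * a + 1) : ℝ) =
      ((2 * Complex.I) ^ (m + 1)).im := by
  have he : ∀ a : ℕ, (Complex.I ^ (2 * a)) = (((-1) ^ a : ℝ) : ℂ) := fun a => by
    rw [pow_mul, Complex.I_sq]; push_cast; rfl
  have h : (2 * Complex.I) ^ (m + 1) = (Complex.I + 1) ^ (2 * m + 2) := by
    rw [show 2 * m + 2 = 2 * (m + 1) by ring, pow_mul]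
    congr 1
    linear_combination -Complex.I_sq
  rw [h, add_pow, show 2 * m + 2 = 2 * (m + 1) by ring,
    Finset.sum_range_succ _ (2 * (m + 1)), sum_range_two_mul,
    Complex.add_im, Complex.im_sum]
  simp only [one_pow, mul_one, pow_succ Complex.I (2 * _), he]
  have hn : ∀ c : ℕ, ((c : ℂ)) = ((c : ℝ) : ℂ) := fun c => by push_cast; rfl
  simp only [hn, Complex.add_im, ← Complex.ofReal_mul, Complex.ofReal_im, mul_assoc,
    Complex.im_ofReal_mul, Complex.im_mul_ofReal, Complex.I_im, zero_add,
    add_zero, one_mul]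

theorem coeff_foursValue (m : ℕ) :
    coeff m foursValue = Real.pi ^ (2 * m) / (Nat.factorial (2 * m + 2) : ℝ) *
      ((2 * Complex.I) ^ (m + 1)).im := by
  rw [← sum_neg_one_pow_mul_choose_odd, foursValue, coeff_mul,
    Finset.Nat.sum_antidiagonal_eq_sum_range_succ_mk, Finset.mul_sum]
  refine Finset.sum_congr rfl fun a ha => ?_
  have ha' : a ≤ m := Nat.lt_succ_iff.1 (Finset.mem_range.1 ha)
  obtain ⟨b, rfl⟩ := Nat.exists_eq_add_of_le ha'
  simp only [evalNegHom, coeff_rescale, twosValue, coeff_mk, multiZeta_repeatList_two,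
    Nat.add_sub_cancel_left]
  rw [Nat.cast_choose ℝ (show 2 * a + 1 ≤ 2 * (a + b) + 2 by omega),
    show 2 * (a + b) + 2 - (2 * a + 1) = 2 * b + 1 by omega]
  field_simp
  ring

theorem coeff_even_foursValue (n : ℕ) :
    coeff (2 * n) foursValue =
      (-4) ^ n * (2 * Real.pi ^ (4 * n) / (Nat.factorial (4 * n + 2) : ℝ)) := by
  have e : ((2 * Complex.I) ^ (2 * n + 1)).im = 2 * (-4) ^ n := by
    have : (2 * Complex.I) ^ (2 * n + 1) = ((2 * (-4) ^ n : ℝ) : ℂ) * Complex.I := by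
      rw [pow_succ, pow_mul, mul_pow, Complex.I_sq]
      push_cast
      norm_num
      ring
    rw [this, Complex.im_ofReal_mul, Complex.I_im, mul_one]
  rw [coeff_foursValue, e, show 2 * (2 * n) = 4 * n by ring]
  ring

theorem coeff_odd_foursValue (n : ℕ) : coeff (2 * n + 1) foursValue = 0 := by
  have : (2 * Complex.I) ^ (2 * n + 1 + 1) = (((-4) ^ (n + 1) : ℝ) : ℂ) := by
    rw [show 2 * n + 1 + 1 = 2 * (n + 1) by ring, pow_mul, mul_pow, Complex.I_sq]
    push_cast
    norm_num
  rw [coeff_foursValue, this, Complex.ofReal_im, mul_zero]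

theorem coeff_odd_powerSumValue (r : ℕ) :
    coeff (2 * r + 1) powerSumValue =
      -(2 ^ (4 * r + 5) * Real.pi ^ (4 * r + 6) * bernoulli' (4 * r + 6) /
        (Nat.factorial (4 * r + 6) : ℝ)) := by
  have h := (hasSum_nat_add_iff' 1).2 (hasSum_zeta_nat (k := 2 * r + 3) (by omega))
  have e : ∑' j : ℕ, (1 / ((j : ℝ) + 1) ^ 2) ^ (2 * r + 1 + 2) = _ :=
    (h.congr_fun fun j => by
      rw [div_pow, one_pow, ← pow_mul]; push_cast; rfl).tsum_eq
  rw [powerSumValue, coeff_mk, e]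
  have e1 : (-1 : ℝ) ^ (2 * r + 1) = -1 := by rw [pow_succ, pow_mul]; simp
  have e2 : (-1 : ℝ) ^ (2 * r + 3 + 1) = 1 := by
    rw [show 2 * r + 3 + 1 = 2 * (r + 2) by ring, pow_mul]; simp
  rw [e1, e2, show 2 * (2 * r + 3) = 4 * r + 6 by ring,
    bernoulli_eq_bernoulli'_of_ne_one (by omega)]
  simp

/-! ### The two identities -/

theorem theorem4p1 (n : ℕ) :
    (Real.pi ^ (4 * n + 2) *
        ∑ p ∈ Finset.range n,
          (-1 : ℝ) ^ (p + 1) * (4 ^ (2 * n - p + 1) * (bernoulli' (4 * n - 4 * p + 2) : ℝ)) /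
            ((Nat.factorial (4 * p + 2) : ℝ) * (Nat.factorial (4 * n - 4 * p + 2) : ℝ)) =
      -2 * ∑ p ∈ Finset.range n,
            (-4 : ℝ) ^ p *
              multiZeta (repeatList [3, 1] p ++ [3, 3] ++ repeatList [2] (2 * (n - p - 1)))
        - 3 * ∑ p ∈ Finset.range n,
            (-4 : ℝ) ^ p *
              multiZeta (repeatList [3, 1] p ++ [4] ++ repeatList [2] (2 * (n - p) - 1))
        + 2 * (-4 : ℝ) ^ n * ∑ p ∈ Finset.range n,
            multiZeta (repeatList [3, 1] p ++ [5, 1] ++ repeatList [3, 1] (n - p - 1))) ∧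
    ((-1 : ℝ) ^ n * 2 * 4 ^ (n + 1) * ((n : ℝ) + 1) * Real.pi ^ (4 * n + 4) /
        (Nat.factorial (4 * n + 6) : ℝ) =
      2 * ∑ p ∈ Finset.range n,
            (-4 : ℝ) ^ p *
              multiZeta (repeatList [3, 1] p ++ [3, 3] ++ repeatList [2] (2 * (n - p) - 1))
        + 3 * ∑ p ∈ Finset.range (n + 1),
            (-4 : ℝ) ^ p *
              multiZeta (repeatList [3, 1] p ++ [4] ++ repeatList [2] (2 * (n - p)))
        - 2 * (-4 : ℝ) ^ n * ∑ p ∈ Finset.range n,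
            multiZeta (repeatList [3, 1] p ++ [3, 4, 1] ++ repeatList [3, 1] (n - p - 1))
        - 2 * (-4 : ℝ) ^ n * ∑ p ∈ Finset.range (n + 1),
            multiZeta (repeatList [3, 1] p ++ [4] ++ repeatList [3, 1] (n - p))) := by
  -- Both sides are the value at `t = 1` of a single coefficient of `altTwosSeries *
  -- insertFourSeries`: the even one for (i), the odd one for (ii).
  have h2 : ∀ k i, 2 ≤ k → Admissible ([k] ++ repeatList [2] i) := fun k i hk =>
    Admissible.append (by simpa [Admissible] using hk) (admissible_repeatList_two i)
  have h33 : ∀ i, Admissible ([3, 3] ++ repeatList [2] i) := fun i =>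
    Admissible.append (by simp [Admissible]) (admissible_repeatList_two i)
  have h31 : ∀ w i, Admissible w → Admissible (w ++ repeatList [3, 1] i) := fun w i hw =>
    hw.append (Admissible.repeatList (by simp [Admissible]) i)
  constructor
  · have hv := (((hasValue_prefixSum (fun _ => 1)
        (fun m => [3, 3] ++ repeatList [2] (2 * (m - 1))) (fun m => h33 _) n).smul (-2)).sub
      ((hasValue_prefixSum (fun _ => 1) (fun m => [4] ++ repeatList [2] (2 * m - 1))
        (fun m => h2 _ _ (by norm_num)) n).smul 3)).add
      ((hasValue_prefixSum (fun m => (-4) ^ m) (fun m => [5, 1] ++ repeatList [3, 1] (m - 1))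
        (fun m => h31 _ _ (by simp [Admissible])) n).smul 2)
    rw [← coeff_even_altTwos_mul_insertFour] at hv
    have e := HasSum.unique (hasValue_coeff_altTwos_mul_insertFour (2 * n)) hv
    have e1 : ∑ p ∈ Finset.range n, ((-4 : ℝ) ^ p * (-4) ^ (n - p)) *
          multiZeta (repeatList [3, 1] p ++ ([5, 1] ++ repeatList [3, 1] (n - p - 1))) =
        (-4) ^ n * ∑ p ∈ Finset.range n,
          multiZeta (repeatList [3, 1] p ++ [5, 1] ++ repeatList [3, 1] (n - p - 1)) := by
      rw [Finset.mul_sum]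
      refine Finset.sum_congr rfl fun p hp => ?_
      rw [pow_mul_pow_sub _ (Finset.mem_range.1 hp).le, List.append_assoc]
    rw [e1] at e
    simp only [mul_one, List.append_assoc] at e
    simp only [List.append_assoc, mul_assoc (2 : ℝ) ((-4) ^ n)]
    rw [← e]
    cases n with
    | zero => simp
    | succ n =>
      rw [show 2 * (n + 1) = 2 * n + 1 + 1 by ring, coeff_succ_X_mul, coeff_mul,
        Finset.Nat.sum_antidiagonal_eq_sum_range_succ_mk,
        show (2 * n + 1).succ = 2 * (n + 1) by omega, sum_range_two_mul, Finset.mul_sum]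
      refine Finset.sum_congr rfl fun p hp => ?_
      obtain ⟨r, rfl⟩ := Nat.exists_eq_add_of_le (Nat.lt_succ_iff.1 (Finset.mem_range.1 hp))
      rw [coeff_odd_foursValue, zero_mul, add_zero, coeff_even_foursValue,
        show 2 * (p + r) + 1 - 2 * p = 2 * r + 1 by omega, coeff_odd_powerSumValue,
        show 4 * (p + r + 1) - 4 * p + 2 = 4 * r + 6 by omega,
        show 2 * (p + r) + 1 + 1 - p + 1 = p + 2 * r + 3 by omega]
      have e4 : (4 : ℝ) ^ (p + 2 * r + 3) = 4 ^ p * (2 * 2 ^ (4 * r + 5)) := by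
        rw [show 4 * r + 5 = 2 * (2 * r) + 5 by ring, pow_add 2 (2 * (2 * r)), pow_mul 2 2 (2 * r)]
        norm_num
        ring
      rw [e4, neg_pow (4 : ℝ) p]
      ring
  · have hv := ((((hasValue_prefixSum (fun _ => 1)
        (fun m => [3, 3] ++ repeatList [2] (2 * m - 1)) (fun m => h33 _) n).smul 2).add
      ((hasValue_prefixSum (fun _ => 1) (fun m => [4] ++ repeatList [2] (2 * (m - 1)))
        (fun m => h2 _ _ (by norm_num)) (n + 1)).smul 3)).sub
      ((hasValue_prefixSum (fun m => (-4) ^ m) (fun m => [3, 4, 1] ++ repeatList [3, 1] (m - 1))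
        (fun m => h31 _ _ (by simp [Admissible])) n).smul 2)).sub
      ((hasValue_prefixSum (fun m => (-4) ^ (m - 1)) (fun m => [4] ++ repeatList [3, 1] (m - 1))
        (fun m => h31 _ _ (by simp [Admissible])) (n + 1)).smul 2)
    rw [← coeff_odd_altTwos_mul_insertFour] at hv
    have e := HasSum.unique (hasValue_coeff_altTwos_mul_insertFour (2 * n + 1)) hv
    rw [coeff_succ_X_mul, coeff_even_foursValue_mul_powerSumValue, coeff_even_foursValue] at e
    have e1 : ∑ p ∈ Finset.range n, ((-4 : ℝ) ^ p * (-4) ^ (n - p)) *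
          multiZeta (repeatList [3, 1] p ++ ([3, 4, 1] ++ repeatList [3, 1] (n - p - 1))) =
        (-4) ^ n * ∑ p ∈ Finset.range n,
          multiZeta (repeatList [3, 1] p ++ [3, 4, 1] ++ repeatList [3, 1] (n - p - 1)) := by
      rw [Finset.mul_sum]
      refine Finset.sum_congr rfl fun p hp => ?_
      rw [pow_mul_pow_sub _ (Finset.mem_range.1 hp).le, List.append_assoc]
    have e2 : ∑ p ∈ Finset.range (n + 1), ((-4 : ℝ) ^ p * (-4) ^ (n + 1 - p - 1)) *
          multiZeta (repeatList [3, 1] p ++ ([4] ++ repeatList [3, 1] (n + 1 - p - 1))) =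
        (-4) ^ n * ∑ p ∈ Finset.range (n + 1),
          multiZeta (repeatList [3, 1] p ++ [4] ++ repeatList [3, 1] (n - p)) := by
      rw [Finset.mul_sum]
      refine Finset.sum_congr rfl fun p hp => ?_
      have hp' : p ≤ n := Nat.lt_succ_iff.1 (Finset.mem_range.1 hp)
      rw [show n + 1 - p - 1 = n - p by omega, pow_mul_pow_sub _ hp', List.append_assoc]
    have e3 : ∑ p ∈ Finset.range (n + 1), ((-4 : ℝ) ^ p * 1) *
          multiZeta (repeatList [3, 1] p ++ ([4] ++ repeatList [2] (2 * (n + 1 - p - 1)))) =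
        ∑ p ∈ Finset.range (n + 1), (-4 : ℝ) ^ p *
          multiZeta (repeatList [3, 1] p ++ [4] ++ repeatList [2] (2 * (n - p))) :=
      Finset.sum_congr rfl fun p hp => by
        rw [show n + 1 - p - 1 = n - p by omega, mul_one, List.append_assoc]
    rw [e1, e2, e3] at e
    simp only [mul_one, List.append_assoc] at e
    simp only [List.append_assoc, mul_assoc (2 : ℝ) ((-4) ^ n)]
    rw [← e, show 4 * (n + 1) + 2 = 4 * n + 6 by ring, show 4 * (n + 1) = 4 * n + 4 by ring,
      neg_pow (4 : ℝ)]
    ring
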